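/- Let $m\ge 2$ and write points of $\mathbb{R}^{2m}$ as $(x_1,y_1,\dots,x_m,y_m)$. Let $F=(-y_1,x_1,-y_2,x_2,\dots,-y_m,x_m)$. For a $C^2$ function $u$ on an open set $\Omega\subset\mathbb{R}^{2m}$ let $S(u)=\{p\in\Omega : \nabla u(p)+F(p)=0\}$ be its singular set and put $N(u)=\frac{\nabla u+F}{|\nabla u+F|}$ on $\Omega\setminus S(u)$. (1) (Comparison principle.) Let $\Omega\subset\mathbb{R}^{2m}$ be a bounded domain (a bounded, connected, non-empty open set), let $u,v\in C^2(\Omega)\cap C^0(\overline\Omega)$ and $S=S(u)\cup S(v)$. If $\operatorname{div}N(u)\ge\operatorname{div}N(v)$ in $\Omega\setminus S$ and $u\le v$ on $\partial\Omega$, then $u\le v$ in $\Omega$. No condition on the size of $S$ is assumed. (2) (Size of the singular set.) Let $\Omega\subset\mathbb{R}^{2m}$ be open and $u\in C^2(\Omega)$. Every $p\in S(u)$ has an open neighbourhood $V\subset\Omega$ such that $S(u)\cap V$ has finite $m$-dimensional Hausdorff measure and is contained in an $m$-dimensional $C^1$ submanifold of $V$, namely in the zero set of a $C^1$ map $g:V\to\mathbb{R}^m$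 whose differential is surjective at every point of $V$. Consequently $\mathcal{H}_{2m-1}(S(u))=0$. -/

import Mathlib

open MeasureTheory

noncomputable section

namespace HeisenbergGraph

/-- Euclidean space `ℝ^{2m}` with coordinates `(x₁, y₁, …, x_m, y_m)`: the coordinate `x_j` is
`p (j, 0)` and the coordinate `y_j` is `p (j, 1)`. -/
abbrev Space (m : ℕ) : Type := EuclideanSpace ℝ (Fin m × Fin 2)

/-- The vector field `F = (-y₁, x₁, -y₂, x₂, …, -y_m, x_m)`. -/
def F {m : ℕ} (p : Space m) : Space m :=
  WithLp.toLp 2 fun i => if i.2 = 0 then -p (i.1, 1) else p (i.1, 0)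

/-- The vector field `α = ∇u + F`. -/
def alpha {m : ℕ} (u : Space m → ℝ) (p : Space m) : Space m :=
  gradient u p + F p

/-- The singular set `S(u) = {p ∈ Ω | ∇u + F = 0 at p}`. -/
def singularSet {m : ℕ} (Ω : Set (Space m)) (u : Space m → ℝ) : Set (Space m) :=
  {p | p ∈ Ω ∧ alpha u p = 0}

/-- The unit vector field `N(u) = (∇u + F) / |∇u + F|`, meaningful off the singular set. -/
def N {m : ℕ} (u : Space m → ℝ) (p : Space m) : Space m :=
  ‖alpha u p‖⁻¹ • alpha u p

/-- The Euclidean divergence `∑ᵢ ∂ᵢ Xᵢ` of a vector field on `ℝ^{2m}`. -/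
def divergence {m : ℕ} (X : Space m → Space m) (p : Space m) : ℝ :=
  ∑ i, (fderiv ℝ X p (EuclideanSpace.single i 1)) i

end HeisenbergGraph

end

/-!
Write `α_u = ∇u + F`, so that `N u = α_u / ‖α_u‖`, and let `S(u)` be the zero set of `α_u`.

**Singular set.** The Hessian of `u` is symmetric and `F` is a skew orthogonal map, so the skew part
of the Jacobian `Dα_u` is the nondegenerate form `⟪F X, Y⟫` (`inner_fderiv_alpha_sub`). The kernel
of `Dα_u` is therefore isotropic, has dimension at most `m`, and `Dα_u` has rank at least `m`
everywhere. Suitable linear combinations of the components of `α_u`, completed by linear functions,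
form local coordinates that are bounded below (`exists_local_chart`). They exhibit `S(u)` as a
subset of an `m`-dimensional submanifold, and show that `{‖α_u‖ ≤ δ}` has volume `O(δ ^ m)` on
compact sets (`exists_volume_inter_norm_alpha_le`).

**Comparison principle.** Let `w = u - v`. The identity
`⟪∇w, N u - N v⟫ = (‖α_u‖ + ‖α_v‖) / 2 * ‖N u - N v‖ ^ 2` (`inner_sub_normalize_sub`) suggests
integrating the divergence of `max (w - ε) 0 ^ 2 • (N u - N v)`, which has compact support in `Ω`
because `w ≤ 0` on the boundary. The field is singular on `S(u) ∪ S(v)`; multiplying it by functions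
of `‖α_u‖ / δ` and `‖α_v‖ / δ` that vanish near the singular sets produces an error term of size
`O(1 / δ)` on a set of volume `O(δ ^ m)`, which disappears as `δ → 0` because `m ≥ 2`
(`fderiv_apply_N_sub_N_nonpos`). Hence `N u = N v` at the nonsingular points where `w > 0`
(`N_eq_of_lt`).

There `α_u = c α_v` for a function `c`. Comparing the skew parts of the derivatives on the hyperplane
orthogonal to `α_v`, whose dimension `2m - 1 > m` prevents it from being isotropic, gives `c = 1`
(`alpha_eq_of_N_eventuallyEq`), that is, `∇w = 0`. The singular sets being null, `∇w = 0` wherever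
`w > 0`, and then the set where `w` attains a positive maximum would be open and compact
(`nonpos_of_fderiv_eq_zero`).
-/

open MeasureTheory Set Filter Topology Module
open scoped RealInnerProductSpace ContDiff NNReal ENNReal

namespace HeisenbergGraph

variable {m : ℕ}

/-! ### The rotation `F` and its isotropic subspaces -/

/-- The field `F` as a linear map: the rotation by a right angle in every plane `(x_j, y_j)`. -/
noncomputable def rotation (m : ℕ) : Space m →L[ℝ] Space m :=
  LinearMap.toContinuousLinearMap
    { toFun := F
      map_add' := fun p q => by
        ext i; by_cases h : i.2 = 0 <;> simp [F, h, add_comm]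
      map_smul' := fun c p => by
        ext i; by_cases h : i.2 = 0 <;> simp [F, h] }

@[simp] lemma rotation_apply (p : Space m) : rotation m p = F p := rfl

lemma F_F (p : Space m) : F (F p) = -p := by
  ext ⟨j, k⟩; fin_cases k <;> simp [F]

lemma inner_F_left (p q : Space m) : ⟪F p, q⟫ = -⟪p, F q⟫ := by
  simp only [PiLp.inner_apply, Fintype.sum_prod_type, Fin.sum_univ_two, ← Finset.sum_neg_distrib]
  refine Finset.sum_congr rfl fun j _ => ?_
  simp [F]

lemma finrank_space : finrank ℝ (Space m) = 2 * m := by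
  simp [finrank_euclideanSpace, mul_comm]

/-- A subspace which is isotropic for the symplectic form `⟪F X, Y⟫` has at most half of the
dimension, since `F` maps it injectively into its orthogonal complement. -/
lemma finrank_le_of_isotropic (T : Submodule ℝ (Space m))
    (hT : ∀ X ∈ T, ∀ Y ∈ T, ⟪F X, Y⟫ = 0) : finrank ℝ T ≤ m := by
  have hinj : Function.Injective (rotation m : Space m →ₗ[ℝ] Space m) := fun p q h => by
    have h' : F p = F q := h
    simpa [F_F] using congrArg F h'
  have hle : T.map (rotation m : Space m →ₗ[ℝ] Space m) ≤ Tᗮ := by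
    rintro _ ⟨X, hX, rfl⟩
    rw [Submodule.mem_orthogonal']
    exact fun Y hY => hT X hX Y hY
  have h1 := Submodule.finrank_mono hle
  rw [(Submodule.equivMapOfInjective _ hinj T).finrank_eq.symm] at h1
  have h2 := T.finrank_add_finrank_orthogonal
  rw [finrank_space] at h2
  omega

/-! ### The derivative of `∇u + F` -/

lemma inner_gradient (u : Space m → ℝ) (p X : Space m) :
    ⟪gradient u p, X⟫ = fderiv ℝ u p X := by
  simp [gradient]

lemma contDiffOn_alpha {Ω : Set (Space m)} (hΩ : IsOpen Ω) {u : Space m → ℝ}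
    (hu : ContDiffOn ℝ 2 u Ω) : ContDiffOn ℝ 1 (alpha u) Ω := by
  have h1 : ContDiffOn ℝ 1 (fderiv ℝ u) Ω := hu.fderiv_of_isOpen hΩ (by norm_num)
  have h2 : ContDiffOn ℝ 1 (gradient u) Ω :=
    (InnerProductSpace.toDual ℝ (Space m)).symm.toContinuousLinearEquiv.contDiff.comp_contDiffOn h1
  exact h2.add (rotation m).contDiff.contDiffOn

/-- The skew part of `D(∇u + F)` is the constant form `⟪F X, Y⟫`, because the Hessian of `u` is
symmetric. -/
lemma inner_fderiv_alpha_sub {Ω : Set (Space m)} (hΩ : IsOpen Ω) {u : Space m → ℝ}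
    (hu : ContDiffOn ℝ 2 u Ω) {p : Space m} (hp : p ∈ Ω) (X Y : Space m) :
    ⟪fderiv ℝ (alpha u) p X, Y⟫ - ⟪fderiv ℝ (alpha u) p Y, X⟫ = 2 * ⟪F X, Y⟫ := by
  have hu' : ContDiffAt ℝ 2 u p := hu.contDiffAt (hΩ.mem_nhds hp)
  have h1 : DifferentiableAt ℝ (fderiv ℝ u) p :=
    (hu'.fderiv_right (m := 1) (by norm_num)).differentiableAt (by norm_num)
  -- over `ℝ` the conjugate-linear Riesz isomorphism is linear
  let e : (Space m →L[ℝ] ℝ) →L[ℝ] Space m := LinearMap.toContinuousLinearMap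
    { toFun := fun l => (InnerProductSpace.toDual ℝ (Space m)).symm l
      map_add' := fun _ _ => map_add _ _ _
      map_smul' := fun _ _ => by simp }
  have h2 : HasFDerivAt (alpha u) (e.comp (fderiv ℝ (fderiv ℝ u) p) + rotation m) p :=
    HasFDerivAt.add (f := fun q => e (fderiv ℝ u q)) (g := rotation m)
      (e.hasFDerivAt.comp p h1.hasFDerivAt) (rotation m).hasFDerivAt
  have hs : IsSymmSndFDerivAt ℝ u p := hu'.isSymmSndFDerivAt (by simp)
  have he : ∀ Z W : Space m, ⟪e (fderiv ℝ (fderiv ℝ u) p Z), W⟫ = fderiv ℝ (fderiv ℝ u) p Z W :=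
    fun Z W => by simp [e]
  rw [h2.fderiv]
  simp only [add_apply, ContinuousLinearMap.comp_apply, inner_add_left, he, rotation_apply]
  rw [hs.eq X Y, inner_F_left Y X, real_inner_comm]
  ring

lemma le_finrank_range_fderiv_alpha {Ω : Set (Space m)} (hΩ : IsOpen Ω) {u : Space m → ℝ}
    (hu : ContDiffOn ℝ 2 u Ω) {p : Space m} (hp : p ∈ Ω) :
    m ≤ finrank ℝ (LinearMap.range (fderiv ℝ (alpha u) p : Space m →ₗ[ℝ] Space m)) := by
  have h1 := LinearMap.finrank_range_add_finrank_ker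
    (fderiv ℝ (alpha u) p : Space m →ₗ[ℝ] Space m)
  have h2 : finrank ℝ (LinearMap.ker (fderiv ℝ (alpha u) p : Space m →ₗ[ℝ] Space m)) ≤ m := by
    refine finrank_le_of_isotropic _ fun X hX Y hY => ?_
    have h := inner_fderiv_alpha_sub hΩ hu hp X Y
    have hX' : fderiv ℝ (alpha u) p X = 0 := hX
    have hY' : fderiv ℝ (alpha u) p Y = 0 := hY
    simp only [hX', hY', inner_zero_left, sub_zero] at h
    linarith
  rw [finrank_space] at h1
  omega

/-! ### Size of the sublevel sets of `|∇u + F|` -/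

lemma hausdorffMeasure_le_image_of_dist_le {X Y : Type*} [MetricSpace X] [MeasurableSpace X]
    [BorelSpace X] [MetricSpace Y] [MeasurableSpace Y] [BorelSpace Y] {f : X → Y} {s : Set X}
    {K : ℝ≥0} (h : ∀ x ∈ s, ∀ y ∈ s, dist x y ≤ K * dist (f x) (f y)) {d : ℝ} (hd : 0 ≤ d) :
    μH[d] s ≤ (K : ℝ≥0∞) ^ d * μH[d] (f '' s) := by
  have h1 : AntilipschitzWith K (s.domRestrict f) :=
    AntilipschitzWith.of_le_mul_dist fun x y => h x x.2 y y.2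
  have h2 := h1.le_hausdorffMeasure_image hd univ
  have h3 := (isometry_subtype_coe (s := s)).hausdorffMeasure_image (d := d) (Or.inl hd) univ
  rw [image_univ, Subtype.range_coe] at h3
  rwa [image_univ, Set.range_domRestrict, ← h3] at h2

lemma exists_clm_surjective_comp (A : Space m →L[ℝ] Space m)
    (hA : m ≤ finrank ℝ (LinearMap.range (A : Space m →ₗ[ℝ] Space m))) :
    ∃ L : Space m →L[ℝ] EuclideanSpace ℝ (Fin m), Function.Surjective (L.comp A) := by
  obtain ⟨i, hi⟩ : ∃ i : EuclideanSpace ℝ (Fin m) →ₗ[ℝ]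
      LinearMap.range (A : Space m →ₗ[ℝ] Space m), Function.Injective i := by
    rw [← finrank_le_iff_exists_linearMap]
    simpa using hA
  obtain ⟨r, hr⟩ := i.exists_leftInverse_of_injective (LinearMap.ker_eq_bot.2 hi)
  obtain ⟨L, hL⟩ := LinearMap.exists_extend r
  refine ⟨LinearMap.toContinuousLinearMap L, fun y => ?_⟩
  obtain ⟨x, hx⟩ := (i y).2
  refine ⟨x, ?_⟩
  have h1 : L (i y) = r (i y) := LinearMap.congr_fun hL (i y)
  have h2 : r (i y) = y := LinearMap.congr_fun hr y
  have hx' : A x = i y := hx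
  simp [hx', h1, h2]

lemma exists_clm_antilipschitz_prod (G : Space m →L[ℝ] EuclideanSpace ℝ (Fin m))
    (hG : Function.Surjective G) :
    ∃ P : Space m →L[ℝ] EuclideanSpace ℝ (Fin m), ∃ K > 0, AntilipschitzWith K (G.prod P) := by
  have hr := LinearMap.finrank_range_add_finrank_ker
    (G : Space m →ₗ[ℝ] EuclideanSpace ℝ (Fin m))
  rw [LinearMap.range_eq_top.2 hG, finrank_top, finrank_space, finrank_euclideanSpace,
    Fintype.card_fin] at hr
  let e : LinearMap.ker (G : Space m →ₗ[ℝ] EuclideanSpace ℝ (Fin m)) ≃ₗ[ℝ]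
      EuclideanSpace ℝ (Fin m) := LinearEquiv.ofFinrankEq _ _ (by simp; omega)
  obtain ⟨P, hP⟩ := LinearMap.exists_extend e.toLinearMap
  refine ⟨LinearMap.toContinuousLinearMap P, ?_⟩
  refine LinearMap.exists_antilipschitzWith
    (G.prod (LinearMap.toContinuousLinearMap P)).toLinearMap ?_
  refine LinearMap.ker_eq_bot'.2 fun x hx => ?_
  have h1 : G x = 0 := congrArg Prod.fst hx
  have h2 : P x = 0 := congrArg Prod.snd hx
  have h3 : P x = e ⟨x, h1⟩ := LinearMap.congr_fun hP ⟨x, h1⟩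
  rw [h2] at h3
  exact congrArg Subtype.val (e.map_eq_zero_iff.1 h3.symm)

/-- The Jacobian of `∇u + F` has rank at least `m`, so `m` suitable linear combinations of the
components of `∇u + F`, completed by linear functions, are local coordinates. -/
lemma exists_local_chart {Ω : Set (Space m)} (hΩ : IsOpen Ω) {u : Space m → ℝ}
    (hu : ContDiffOn ℝ 2 u Ω) {p : Space m} (hp : p ∈ Ω) :
    ∃ (L P : Space m →L[ℝ] EuclideanSpace ℝ (Fin m)) (V : Set (Space m)) (K : ℝ≥0),
      IsOpen V ∧ p ∈ V ∧ V ⊆ Ω ∧ Bornology.IsBounded V ∧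
      (∀ x ∈ V, ∀ y ∈ V,
        dist x y ≤ K * max (dist (L (alpha u x)) (L (alpha u y))) (dist (P x) (P y))) ∧
      ∀ q ∈ V, Function.Surjective (fderiv ℝ (fun x => L (alpha u x)) q) := by
  obtain ⟨L, hL⟩ := exists_clm_surjective_comp _ (le_finrank_range_fderiv_alpha hΩ hu hp)
  set G := L.comp (fderiv ℝ (alpha u) p) with hGdef
  obtain ⟨P, K, hK, hGP⟩ := exists_clm_antilipschitz_prod G hL
  have hα : ContDiffAt ℝ 1 (alpha u) p := (contDiffOn_alpha hΩ hu).contDiffAt (hΩ.mem_nhds hp)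
  have hg : ContDiffAt ℝ 1 (fun x => L (alpha u x)) p := L.contDiff.contDiffAt.comp p hα
  have hGd : HasStrictFDerivAt (fun x => L (alpha u x)) G p :=
    L.hasStrictFDerivAt.comp p (hα.hasStrictFDerivAt (by norm_num))
  have hGf : fderiv ℝ (fun x => L (alpha u x)) p = G := hGd.hasFDerivAt.fderiv
  -- surjectivity of the differential persists near `p`
  obtain ⟨R, hR⟩ := G.exists_rightInverse_of_surjective (LinearMap.range_eq_top.2 hL)
  have hsurj : ∀ᶠ q in 𝓝 p, Function.Surjective (fderiv ℝ (fun x => L (alpha u x)) q) := by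
    have hc : ContinuousAt (fun q => (fderiv ℝ (fun x => L (alpha u x)) q).comp R) p :=
      (hg.continuousAt_fderiv (by norm_num)).clm_comp continuousAt_const
    have h1 : {x : EuclideanSpace ℝ (Fin m) →L[ℝ] EuclideanSpace ℝ (Fin m) | IsUnit x} ∈
        𝓝 ((fderiv ℝ (fun x => L (alpha u x)) p).comp R) := by
      rw [hGf, hR]
      exact Units.nhds 1
    filter_upwards [hc h1] with q hq
    have hq' : IsUnit ((fderiv ℝ (fun x => L (alpha u x)) q).comp R) := hq
    intro y
    obtain ⟨U, hU⟩ := hq'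
    refine ⟨R ((↑U⁻¹ : EuclideanSpace ℝ (Fin m) →L[ℝ] EuclideanSpace ℝ (Fin m)) y), ?_⟩
    have h2 := congrArg (fun T : EuclideanSpace ℝ (Fin m) →L[ℝ] EuclideanSpace ℝ (Fin m) =>
      T y) U.mul_inv
    rw [hU] at h2
    exact h2
  -- a map whose strict derivative is bounded below is bounded below near the point
  have hc : (0 : ℝ≥0) < (2 * K)⁻¹ := by positivity
  obtain ⟨s, hs, hA⟩ := (hGd.prodMk P.hasStrictFDerivAt).approximates_deriv_on_nhds
    (c := (2 * K)⁻¹) (Or.inr hc)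
  have hanti : ∀ x ∈ s, ∀ y ∈ s, dist x y ≤
      (2 * K : ℝ≥0) * max (dist (L (alpha u x)) (L (alpha u y))) (dist (P x) (P y)) := by
    intro x hx y hy
    have h1 : ‖x - y‖ ≤ K * ‖(G.prod P) (x - y)‖ := by
      simpa [dist_eq_norm] using hGP.le_mul_dist (x - y) 0
    have h2 := hA x hx y hy
    set a := (L (alpha u x), P x) - (L (alpha u y), P y) with ha
    have h3 : ‖(G.prod P) (x - y)‖ ≤ ‖a‖ + ‖a - (G.prod P) (x - y)‖ := by
      have := norm_sub_le a (a - (G.prod P) (x - y))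
      rwa [sub_sub_cancel] at this
    have hKr : (0 : ℝ) < K := hK
    have h4 : ‖a - (G.prod P) (x - y)‖ ≤ (2 * (K : ℝ))⁻¹ * ‖x - y‖ := by simpa using h2
    have h5 : max (dist (L (alpha u x)) (L (alpha u y))) (dist (P x) (P y)) = ‖a‖ := by
      simp [ha, dist_eq_norm, Prod.norm_def]
    rw [h5, dist_eq_norm]
    have h6 : ‖x - y‖ ≤ K * (‖a‖ + (2 * (K : ℝ))⁻¹ * ‖x - y‖) :=
      h1.trans (mul_le_mul_of_nonneg_left (h3.trans (by linarith)) hKr.le)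
    have h7 : (K : ℝ) * (‖a‖ + (2 * (K : ℝ))⁻¹ * ‖x - y‖) = K * ‖a‖ + ‖x - y‖ / 2 := by
      field_simp
    push_cast
    linarith
  obtain ⟨V, hV, hVo, hpV⟩ := eventually_nhds_iff.1
    (hsurj.and ((eventually_mem_set.2 hs).and ((hΩ.eventually_mem hp).and
      (Metric.ball_mem_nhds p one_pos))))
  exact ⟨L, P, V, 2 * K, hVo, hpV, fun x hx => (hV x hx).2.2.1,
    Metric.isBounded_ball.subset fun x hx => (hV x hx).2.2.2,
    fun x hx y hy => hanti x (hV x hx).2.1 y (hV y hy).2.1, fun q hq => (hV q hq).1⟩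

lemma hausdorffMeasure_singularSet_inter_lt_top {Ω V : Set (Space m)} {u : Space m → ℝ}
    {L P : Space m →L[ℝ] EuclideanSpace ℝ (Fin m)} {K : ℝ≥0} (hV : Bornology.IsBounded V)
    (h : ∀ x ∈ V, ∀ y ∈ V,
      dist x y ≤ K * max (dist (L (alpha u x)) (L (alpha u y))) (dist (P x) (P y))) :
    μH[(m : ℝ)] (singularSet Ω u ∩ V) < ⊤ := by
  have hb : Bornology.IsBounded (P '' (singularSet Ω u ∩ V)) :=
    P.lipschitz.isBounded_image (hV.subset inter_subset_right)
  have : (μH[(m : ℝ)] : Measure (EuclideanSpace ℝ (Fin m))).IsAddHaarMeasure := by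
    simpa using isAddHaarMeasure_hausdorffMeasure (E := EuclideanSpace ℝ (Fin m))
  refine (hausdorffMeasure_le_image_of_dist_le (f := P) (K := K) (fun x hx y hy => ?_)
    (Nat.cast_nonneg m)).trans_lt
    (ENNReal.mul_lt_top (ENNReal.rpow_lt_top_of_nonneg (Nat.cast_nonneg m) ENNReal.coe_ne_top)
      hb.measure_lt_top)
  simpa [hx.1.2, hy.1.2] using h x hx.2 y hy.2

/-- In local coordinates `(L(∇u + F), P)` the set `|∇u + F| ≤ δ` lies in the product of a ball of
radius `O(δ)` in `ℝ^m` with a bounded set. -/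
lemma volume_inter_norm_alpha_le {V : Set (Space m)} {u : Space m → ℝ}
    {L P : Space m →L[ℝ] EuclideanSpace ℝ (Fin m)} {K : ℝ≥0} (hV : Bornology.IsBounded V)
    (h : ∀ x ∈ V, ∀ y ∈ V,
      dist x y ≤ K * max (dist (L (alpha u x)) (L (alpha u y))) (dist (P x) (P y))) :
    ∃ C : ℝ≥0∞, C ≠ ⊤ ∧ ∀ δ : ℝ, 0 ≤ δ →
      volume (V ∩ {x | ‖alpha u x‖ ≤ δ}) ≤ C * ENNReal.ofReal (δ ^ m) := by
  have hE : (μH[((2 * m : ℕ) : ℝ)] : Measure (Space m)).IsAddHaarMeasure := by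
    have := isAddHaarMeasure_hausdorffMeasure (E := Space m)
    rwa [finrank_space] at this
  have hE' : (μH[((2 * m : ℕ) : ℝ)] : Measure
      (EuclideanSpace ℝ (Fin m) × EuclideanSpace ℝ (Fin m))).IsAddHaarMeasure := by
    have := isAddHaarMeasure_hausdorffMeasure
      (E := EuclideanSpace ℝ (Fin m) × EuclideanSpace ℝ (Fin m))
    rwa [finrank_prod, finrank_euclideanSpace, Fintype.card_fin, ← two_mul] at this
  obtain ⟨R, hR⟩ : ∃ R, P '' V ⊆ Metric.closedBall 0 R :=
    (P.lipschitz.isBounded_image hV).subset_closedBall 0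
  have hvol : (volume : Measure
      (EuclideanSpace ℝ (Fin m) × EuclideanSpace ℝ (Fin m))).IsAddHaarMeasure :=
    inferInstanceAs (Measure.prod volume volume).IsAddHaarMeasure
  set c : ℝ≥0 := Measure.addHaarScalarFactor (volume : Measure (Space m)) μH[((2 * m : ℕ) : ℝ)]
  set c' : ℝ≥0 := Measure.addHaarScalarFactor
    (μH[((2 * m : ℕ) : ℝ)] : Measure (EuclideanSpace ℝ (Fin m) × EuclideanSpace ℝ (Fin m))) volume
  set B := volume (Metric.ball (0 : EuclideanSpace ℝ (Fin m)) 1)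
  set D := volume (Metric.closedBall (0 : EuclideanSpace ℝ (Fin m)) R)
  refine ⟨c * ((K : ℝ≥0∞) ^ ((2 * m : ℕ) : ℝ) * (c' * (ENNReal.ofReal (‖L‖ ^ m) * B * D))), ?_,
    fun δ hδ => ?_⟩
  · have hB : B ≠ ⊤ := Metric.isBounded_ball.measure_lt_top.ne
    have hD : D ≠ ⊤ := Metric.isBounded_closedBall.measure_lt_top.ne
    have hK : (K : ℝ≥0∞) ^ ((2 * m : ℕ) : ℝ) ≠ ⊤ :=
      (ENNReal.rpow_lt_top_of_nonneg (Nat.cast_nonneg _) ENNReal.coe_ne_top).ne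
    exact ENNReal.mul_ne_top ENNReal.coe_ne_top (ENNReal.mul_ne_top hK
      (ENNReal.mul_ne_top ENNReal.coe_ne_top
        (ENNReal.mul_ne_top (ENNReal.mul_ne_top ENNReal.ofReal_ne_top hB) hD)))
  · set s := V ∩ {x | ‖alpha u x‖ ≤ δ}
    have h1 : volume s = c * μH[((2 * m : ℕ) : ℝ)] s := by
      rw [Measure.isAddLeftInvariant_eq_smul (volume : Measure (Space m)) μH[((2 * m : ℕ) : ℝ)]]
      rfl
    set Φ : Space m → EuclideanSpace ℝ (Fin m) × EuclideanSpace ℝ (Fin m) :=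
      fun x => (L (alpha u x), P x)
    have h2 : μH[((2 * m : ℕ) : ℝ)] s ≤
        (K : ℝ≥0∞) ^ ((2 * m : ℕ) : ℝ) * μH[((2 * m : ℕ) : ℝ)] (Φ '' s) :=
      hausdorffMeasure_le_image_of_dist_le (fun x hx y hy => h x hx.1 y hy.1) (Nat.cast_nonneg _)
    have h3 : μH[((2 * m : ℕ) : ℝ)] (Φ '' s) = c' * volume (Φ '' s) := by
      rw [Measure.isAddLeftInvariant_eq_smul (μH[((2 * m : ℕ) : ℝ)] : Measure
        (EuclideanSpace ℝ (Fin m) × EuclideanSpace ℝ (Fin m))) volume]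
      rfl
    have h4 : Φ '' s ⊆ Metric.closedBall 0 (‖L‖ * δ) ×ˢ Metric.closedBall 0 R := by
      rintro _ ⟨x, hx, rfl⟩
      refine ⟨?_, hR ⟨x, hx.1, rfl⟩⟩
      rw [mem_closedBall_zero_iff]
      exact (L.le_opNorm _).trans (mul_le_mul_of_nonneg_left hx.2 (norm_nonneg _))
    have h5 : volume (Φ '' s) ≤ ENNReal.ofReal (‖L‖ ^ m) * ENNReal.ofReal (δ ^ m) * B * D := by
      refine (measure_mono h4).trans_eq ?_
      rw [Measure.volume_eq_prod, Measure.prod_prod,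
        Measure.addHaar_closedBall _ _ (by positivity), finrank_euclideanSpace, Fintype.card_fin,
        mul_pow, ENNReal.ofReal_mul (by positivity)]
    rw [h1]
    calc (c : ℝ≥0∞) * μH[((2 * m : ℕ) : ℝ)] s
        ≤ c * ((K : ℝ≥0∞) ^ ((2 * m : ℕ) : ℝ) *
          (c' * (ENNReal.ofReal (‖L‖ ^ m) * ENNReal.ofReal (δ ^ m) * B * D))) := by
          rw [h3] at h2
          gcongr
          exact h2.trans (by gcongr)
      _ = _ := by ring

lemma exists_volume_inter_norm_alpha_le {Ω : Set (Space m)} (hΩ : IsOpen Ω) {u : Space m → ℝ}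
    (hu : ContDiffOn ℝ 2 u Ω) {A : Set (Space m)} (hA : IsCompact A) (hAΩ : A ⊆ Ω) :
    ∃ C : ℝ≥0∞, C ≠ ⊤ ∧ ∀ δ : ℝ, 0 ≤ δ →
      volume (A ∩ {x | ‖alpha u x‖ ≤ δ}) ≤ C * ENNReal.ofReal (δ ^ m) := by
  refine hA.induction_on (p := fun A => ∃ C : ℝ≥0∞, C ≠ ⊤ ∧ ∀ δ : ℝ, 0 ≤ δ →
      volume (A ∩ {x | ‖alpha u x‖ ≤ δ}) ≤ C * ENNReal.ofReal (δ ^ m)) ?_ ?_ ?_ ?_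
  · exact ⟨0, by simp, by simp⟩
  · rintro s t hst ⟨C, hC, h⟩
    exact ⟨C, hC, fun δ hδ => (measure_mono (inter_subset_inter_left _ hst)).trans (h δ hδ)⟩
  · rintro s t ⟨C, hC, h⟩ ⟨C', hC', h'⟩
    refine ⟨C + C', ENNReal.add_ne_top.2 ⟨hC, hC'⟩, fun δ hδ => ?_⟩
    rw [union_inter_distrib_right, add_mul]
    exact (measure_union_le _ _).trans (add_le_add (h δ hδ) (h' δ hδ))
  · intro p hp
    obtain ⟨L, P, V, K, hVo, hpV, -, hVb, hd, -⟩ := exists_local_chart hΩ hu (hAΩ hp)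
    exact ⟨V, mem_nhdsWithin_of_mem_nhds (hVo.mem_nhds hpV), volume_inter_norm_alpha_le hVb hd⟩

lemma hausdorffMeasure_singularSet_eq_zero {Ω : Set (Space m)} (hΩ : IsOpen Ω) {u : Space m → ℝ}
    (hu : ContDiffOn ℝ 2 u Ω) {d : ℝ} (hd : (m : ℝ) < d) : μH[d] (singularSet Ω u) = 0 := by
  refine measure_null_of_locally_null _ fun p hp => ?_
  obtain ⟨L, P, V, K, hVo, hpV, -, hVb, hdist, -⟩ := exists_local_chart hΩ hu hp.1
  exact ⟨singularSet Ω u ∩ V, inter_mem_nhdsWithin _ (hVo.mem_nhds hpV),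
    (Measure.hausdorffMeasure_zero_or_top hd _).resolve_right
      (hausdorffMeasure_singularSet_inter_lt_top hVb hdist).ne⟩

lemma volume_singularSet (hm : 1 ≤ m) {Ω : Set (Space m)} (hΩ : IsOpen Ω) {u : Space m → ℝ}
    (hu : ContDiffOn ℝ 2 u Ω) : volume (singularSet Ω u) = 0 := by
  refine measure_null_of_locally_null _ fun p hp => ?_
  obtain ⟨L, P, V, K, hVo, hpV, -, hVb, hdist, -⟩ := exists_local_chart hΩ hu hp.1
  obtain ⟨C, -, hC⟩ := volume_inter_norm_alpha_le hVb hdist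
  refine ⟨singularSet Ω u ∩ V, inter_mem_nhdsWithin _ (hVo.mem_nhds hpV), ?_⟩
  have h0 := hC 0 le_rfl
  rw [zero_pow (by omega), ENNReal.ofReal_zero, mul_zero] at h0
  refine measure_mono_null (fun x hx => ?_) (nonpos_iff_eq_zero.1 h0)
  exact ⟨hx.2, by simp [hx.1.2]⟩

/-- Near a singular point, `m` suitable linear combinations of the components of `∇u + F` cut out a
submanifold containing the singular set. -/
lemma exists_submersion_near_singular_point {Ω : Set (Space m)} (hΩ : IsOpen Ω) {u : Space m → ℝ}
    (hu : ContDiffOn ℝ 2 u Ω) {p : Space m} (hp : p ∈ singularSet Ω u) :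
    ∃ V : Set (Space m), IsOpen V ∧ p ∈ V ∧ V ⊆ Ω ∧
      (∃ g : Space m → EuclideanSpace ℝ (Fin m), ContDiffOn ℝ 1 g V ∧
        (∀ q ∈ V, Function.Surjective (fderiv ℝ g q)) ∧
        ∀ q ∈ singularSet Ω u ∩ V, g q = 0) ∧
      μH[(m : ℝ)] (singularSet Ω u ∩ V) < ⊤ := by
  obtain ⟨L, P, V, K, hVo, hpV, hVΩ, hVb, hdist, hsurj⟩ := exists_local_chart hΩ hu hp.1
  refine ⟨V, hVo, hpV, hVΩ, ⟨fun x => L (alpha u x), ?_, hsurj, fun q hq => ?_⟩,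
    hausdorffMeasure_singularSet_inter_lt_top hVb hdist⟩
  · exact L.contDiff.comp_contDiffOn ((contDiffOn_alpha hΩ hu).mono hVΩ)
  · simp [hq.1.2]

/-! ### The field `N(u)` -/

lemma inner_sub_normalize_sub {E : Type*} [NormedAddCommGroup E] [InnerProductSpace ℝ E] {a b : E}
    (ha : a ≠ 0) (hb : b ≠ 0) :
    ⟪a - b, ‖a‖⁻¹ • a - ‖b‖⁻¹ • b⟫ =
      (‖a‖ + ‖b‖) / 2 * ‖‖a‖⁻¹ • a - ‖b‖⁻¹ • b‖ ^ 2 := by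
  have ha' : ‖a‖ ≠ 0 := norm_ne_zero_iff.2 ha
  have hb' : ‖b‖ ≠ 0 := norm_ne_zero_iff.2 hb
  rw [norm_sub_sq_real, norm_smul, norm_smul, norm_inv, norm_inv, norm_norm, norm_norm,
    inv_mul_cancel₀ ha', inv_mul_cancel₀ hb']
  simp only [inner_sub_left, inner_sub_right, real_inner_smul_left, real_inner_smul_right,
    real_inner_self_eq_norm_sq, real_inner_comm a b]
  field_simp
  ring

lemma norm_N_le (u : Space m → ℝ) (p : Space m) : ‖N u p‖ ≤ 1 := by
  rw [N, norm_smul, norm_inv, norm_norm]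
  exact inv_mul_le_one

lemma contDiffAt_N {u : Space m → ℝ} {p : Space m} (hu : ContDiffAt ℝ 1 (alpha u) p)
    (hp : alpha u p ≠ 0) : ContDiffAt ℝ 1 (N u) p :=
  ((hu.norm ℝ hp).inv (norm_ne_zero_iff.2 hp)).smul hu

/-- If the normals agree near `p`, then `∇u + F = c (∇v + F)` with a scalar function `c`. On the
hyperplane orthogonal to `∇v + F` the skew parts of the two derivatives are then in the ratio `c`;
both equal the form `⟪F X, Y⟫`, which cannot vanish on a subspace of dimension `2m - 1 > m`. -/
lemma alpha_eq_of_N_eventuallyEq (hm : 2 ≤ m) {Ω : Set (Space m)} (hΩ : IsOpen Ω)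
    {u v : Space m → ℝ} (hu : ContDiffOn ℝ 2 u Ω) (hv : ContDiffOn ℝ 2 v Ω) {p : Space m}
    (hp : p ∈ Ω) (hup : alpha u p ≠ 0) (hvp : alpha v p ≠ 0) (h : N u =ᶠ[𝓝 p] N v) :
    alpha u p = alpha v p := by
  have hαu : ContDiffAt ℝ 1 (alpha u) p := (contDiffOn_alpha hΩ hu).contDiffAt (hΩ.mem_nhds hp)
  have hαv : ContDiffAt ℝ 1 (alpha v) p := (contDiffOn_alpha hΩ hv).contDiffAt (hΩ.mem_nhds hp)
  set c : Space m → ℝ := fun q => ‖alpha u q‖ * ‖alpha v q‖⁻¹ with hc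
  have hcd : DifferentiableAt ℝ c p :=
    ((hαu.norm ℝ hup).mul ((hαv.norm ℝ hvp).inv (norm_ne_zero_iff.2 hvp))).differentiableAt
      (by norm_num)
  have heq : alpha u =ᶠ[𝓝 p] fun q => c q • alpha v q := by
    filter_upwards [h, hαu.continuousAt.eventually_ne hup] with q hq hq'
    have h1 : ‖alpha u q‖ • N u q = alpha u q := by
      rw [N, smul_smul, mul_inv_cancel₀ (norm_ne_zero_iff.2 hq'), one_smul]
    rw [← h1, hq, N, smul_smul]
  have hd : fderiv ℝ (alpha u) p =
      c p • fderiv ℝ (alpha v) p + (fderiv ℝ c p).smulRight (alpha v p) := by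
    rw [heq.fderiv_eq]
    exact fderiv_fun_smul hcd (hαv.differentiableAt (by norm_num))
  have hc1 : c p = 1 := by
    by_contra hne
    have hT : finrank ℝ ((ℝ ∙ alpha v p)ᗮ : Submodule ℝ (Space m)) ≤ m := by
      refine finrank_le_of_isotropic _ fun X hX Y hY => ?_
      have hX' := Submodule.mem_orthogonal_singleton_iff_inner_right.1 hX
      have hY' := Submodule.mem_orthogonal_singleton_iff_inner_right.1 hY
      have h1 := inner_fderiv_alpha_sub hΩ hu hp X Y
      have h2 := inner_fderiv_alpha_sub hΩ hv hp X Y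
      rw [hd] at h1
      simp only [add_apply, smul_apply, ContinuousLinearMap.smulRight_apply,
        inner_add_left, real_inner_smul_left, hX', hY', mul_zero, add_zero] at h1
      have h3 : (c p - 1) * ⟪F X, Y⟫ = 0 := by linear_combination h1 / 2 - c p / 2 * h2
      exact (mul_eq_zero.1 h3).resolve_left (sub_ne_zero.2 hne)
    have h4 := (ℝ ∙ alpha v p).finrank_add_finrank_orthogonal
    rw [finrank_space, finrank_span_singleton hvp] at h4
    omega
  have h5 := heq.self_of_nhds
  simpa [hc1] using h5

/-! ### Conclusion from equality of the normals -/

lemma fderiv_eq_of_alpha_eq {u v : Space m → ℝ} {p : Space m} (h : alpha u p = alpha v p) :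
    fderiv ℝ u p = fderiv ℝ v p := by
  have h1 : gradient u p = gradient v p := add_right_cancel h
  exact (InnerProductSpace.toDual ℝ (Space m)).symm.injective h1

lemma fderiv_eq_of_N_eq (hm : 2 ≤ m) {Ω : Set (Space m)} (hΩ : IsOpen Ω)
    {u v : Space m → ℝ} (hu : ContDiffOn ℝ 2 u Ω) (hv : ContDiffOn ℝ 2 v Ω)
    (h : ∀ p ∈ Ω, v p < u p → alpha u p ≠ 0 → alpha v p ≠ 0 → N u p = N v p)
    {p : Space m} (hp : p ∈ Ω) (hlt : v p < u p) : fderiv ℝ u p = fderiv ℝ v p := by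
  by_contra hne
  have hc : ∀ {f : Space m → ℝ}, ContDiffOn ℝ 2 f Ω → ∀ {q}, q ∈ Ω →
      ContinuousAt f q ∧ ContinuousAt (fderiv ℝ f) q ∧ ContinuousAt (alpha f) q :=
    fun hf q hq =>
      ⟨(hf.contDiffAt (hΩ.mem_nhds hq)).continuousAt,
        (hf.contDiffAt (hΩ.mem_nhds hq)).continuousAt_fderiv (by norm_num),
        ((contDiffOn_alpha hΩ hf).contDiffAt (hΩ.mem_nhds hq)).continuousAt⟩
  have hev : ∀ᶠ q in 𝓝 p, q ∈ Ω ∧ v q < u q ∧ fderiv ℝ u q ≠ fderiv ℝ v q :=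
    (hΩ.eventually_mem hp).and (((hc hv hp).1.eventually_lt (hc hu hp).1 hlt).and
      ((((hc hu hp).2.1.sub (hc hv hp).2.1).eventually_ne (sub_ne_zero.2 hne)).mono
        fun _ => sub_ne_zero.1))
  obtain ⟨O, hO, hOo, hpO⟩ := eventually_nhds_iff.1 hev
  -- a null set cannot contain the open set `O`
  have hnull : volume (singularSet Ω u ∪ singularSet Ω v) = 0 :=
    measure_union_null (volume_singularSet (by omega) hΩ hu) (volume_singularSet (by omega) hΩ hv)
  have hpos : 0 < volume O := hOo.measure_pos volume ⟨p, hpO⟩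
  obtain ⟨q, hqO, hqS⟩ : ∃ q ∈ O, q ∉ singularSet Ω u ∪ singularSet Ω v := by
    by_contra! hsub
    exact hpos.ne' (measure_mono_null hsub hnull)
  have hqΩ := (hO q hqO).1
  have hqu : alpha u q ≠ 0 := fun h0 => hqS (Or.inl ⟨hqΩ, h0⟩)
  have hqv : alpha v q ≠ 0 := fun h0 => hqS (Or.inr ⟨hqΩ, h0⟩)
  refine (hO q hqO).2.2 (fderiv_eq_of_alpha_eq
    (alpha_eq_of_N_eventuallyEq hm hΩ hu hv hqΩ hqu hqv ?_))
  filter_upwards [hOo.eventually_mem hqO, (hc hu hqΩ).2.2.eventually_ne hqu,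
    (hc hv hqΩ).2.2.eventually_ne hqv] with x hx hxu hxv
  exact h x (hO x hx).1 (hO x hx).2.1 hxu hxv

/-- A function which is nonpositive on the boundary of a bounded open set and whose derivative
vanishes where it is positive is nonpositive: otherwise the set where its maximum is attained would
be compact and open. -/
lemma nonpos_of_fderiv_eq_zero {E : Type*} [NormedAddCommGroup E] [NormedSpace ℝ E]
    [FiniteDimensional ℝ E] [Nontrivial E] {Ω : Set E} (hΩ : IsOpen Ω)
    (hb : Bornology.IsBounded Ω) {w : E → ℝ} (hw : ContinuousOn w (closure Ω))
    (hd : ∀ p ∈ Ω, 0 < w p → DifferentiableAt ℝ w p ∧ fderiv ℝ w p = 0)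
    (hf : ∀ p ∈ frontier Ω, w p ≤ 0) {p : E} (hp : p ∈ Ω) : w p ≤ 0 := by
  by_contra! hpos
  have hcpt : IsCompact (closure Ω) := Metric.isCompact_of_isClosed_isBounded isClosed_closure
    hb.closure
  obtain ⟨q, hq, hmax⟩ := hcpt.exists_isMaxOn ⟨p, subset_closure hp⟩ hw
  have hwq : 0 < w q := hpos.trans_le (hmax (subset_closure hp))
  set A := closure Ω ∩ w ⁻¹' {w q}
  have hAΩ : A ⊆ Ω := fun x hx => by
    by_contra hxΩ
    have h1 : x ∈ frontier Ω := ⟨hx.1, fun h => hxΩ (interior_subset h)⟩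
    have h2 : w x = w q := hx.2
    linarith [hf x h1]
  have hAc : IsClosed A := hw.preimage_isClosed_of_isClosed isClosed_closure isClosed_singleton
  have hAo : IsOpen A := by
    rw [isOpen_iff_mem_nhds]
    intro x hx
    have hxq : w x = w q := hx.2
    have hev : ∀ᶠ y in 𝓝 x, y ∈ Ω ∧ 0 < w y :=
      (hΩ.eventually_mem (hAΩ hx)).and
        ((hw.continuousAt
          (mem_of_superset (hΩ.mem_nhds (hAΩ hx)) subset_closure)).eventually_const_lt
            (by rw [hxq]; exact hwq))
    obtain ⟨r, hr, hball⟩ := Metric.eventually_nhds_iff_ball.1 hev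
    refine mem_of_superset (Metric.ball_mem_nhds x hr) fun y hy =>
      ⟨subset_closure (hball y hy).1, ?_⟩
    have h3 : w y = w x := (convex_ball x r).is_const_of_fderivWithin_eq_zero
      (fun z hz => (hd z (hball z hz).1 (hball z hz).2).1.differentiableWithinAt)
      (fun z hz => by
        rw [fderivWithin_of_isOpen Metric.isOpen_ball hz]
        exact (hd z (hball z hz).1 (hball z hz).2).2) hy (Metric.mem_ball_self hr)
    exact h3.trans hxq
  have huniv : A = univ := IsClopen.eq_univ ⟨hAc, hAo⟩ ⟨q, hq, rfl⟩
  have hbu : Bornology.IsBounded (univ : Set E) := huniv ▸ hb.subset hAΩ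
  exact NormedSpace.noncompactSpace ℝ E |>.noncompact_univ
    (Metric.isCompact_of_isClosed_isBounded isClosed_univ hbu)

/-! ### Divergence of vector fields -/

lemma integral_divergence_eq_zero {X : Space m → Space m} (hX : ContDiff ℝ 1 X)
    (hc : HasCompactSupport X) : ∫ x, divergence X x = 0 := by
  have hcont : Continuous (fderiv ℝ X) := hX.continuous_fderiv (by norm_num)
  have hint : ∀ i, Integrable (fun x => (fderiv ℝ X x (EuclideanSpace.single i 1)) i) := by
    intro i
    refine Continuous.integrable_of_hasCompactSupport ?_ ?_
    · exact (EuclideanSpace.proj (𝕜 := ℝ) i).continuous.comp (hcont.clm_apply continuous_const)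
    · exact (hc.fderiv ℝ).comp_left
        (g := fun T : Space m →L[ℝ] Space m => (T (EuclideanSpace.single i 1)) i) (by simp)
  simp only [divergence]
  rw [integral_finsetSum _ fun i _ => hint i]
  refine Finset.sum_eq_zero fun i _ => ?_
  have hcomp : ∀ x v, fderiv ℝ (fun x => X x i) x v = (fderiv ℝ X x v) i := fun x v => by
    have := ((EuclideanSpace.proj (𝕜 := ℝ) i).hasFDerivAt.comp x
      (hX.differentiable (by norm_num) x).hasFDerivAt).fderiv
    exact congrArg (fun T : Space m →L[ℝ] ℝ => T v) this
  have hXi : ContDiff ℝ 1 fun x => X x i := (EuclideanSpace.proj (𝕜 := ℝ) i).contDiff.comp hX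
  have hparts := integral_mul_fderiv_eq_neg_fderiv_mul_of_integrable (μ := volume)
    (f := fun _ : Space m => (1 : ℝ)) (g := fun x => X x i) (v := EuclideanSpace.single i 1)
    (by simp) (by simpa [hcomp] using hint i)
    (by
      simp only [one_mul]
      exact hXi.continuous.integrable_of_hasCompactSupport
        (hc.comp_left (g := fun y : Space m => y i) (by simp)))
    (fun x _ => differentiableAt_const _) (fun x _ => hXi.differentiable (by norm_num) x)
  simpa [hcomp] using hparts

lemma divergence_smul {f : Space m → ℝ} {Y : Space m → Space m} {x : Space m}
    (hf : DifferentiableAt ℝ f x) (hY : DifferentiableAt ℝ Y x) :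
    divergence (fun x => f x • Y x) x = f x * divergence Y x + fderiv ℝ f x (Y x) := by
  have h1 : Y x = ∑ i, Y x i • EuclideanSpace.single i (1 : ℝ) := by
    simpa using ((EuclideanSpace.basisFun (Fin m × Fin 2) ℝ).sum_repr (Y x)).symm
  have h2 : fderiv ℝ f x (Y x) = ∑ i, fderiv ℝ f x (EuclideanSpace.single i 1) * Y x i := by
    conv_lhs => rw [h1]
    rw [map_sum]
    exact Finset.sum_congr rfl fun i _ => by rw [map_smul, smul_eq_mul, mul_comm]
  rw [h2]
  simp only [divergence]
  rw [fderiv_fun_smul hf hY, Finset.mul_sum, ← Finset.sum_add_distrib]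
  exact Finset.sum_congr rfl fun i _ => by simp

lemma divergence_sub {Y Z : Space m → Space m} {x : Space m}
    (hY : DifferentiableAt ℝ Y x) (hZ : DifferentiableAt ℝ Z x) :
    divergence (fun x => Y x - Z x) x = divergence Y x - divergence Z x := by
  simp only [divergence]
  rw [fderiv_fun_sub hY hZ, ← Finset.sum_sub_distrib]
  exact Finset.sum_congr rfl fun i _ => by simp

lemma divergence_eq_zero_of_eventuallyEq {X : Space m → Space m} {x : Space m}
    (h : X =ᶠ[𝓝 x] fun _ => 0) : divergence X x = 0 := by
  simp [divergence, h.fderiv_eq]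

/-! ### Cutting off the singular set -/

section Cutoff

variable {E : Type*} [NormedAddCommGroup E]

/-- A cutoff function along a vector field `a`: it vanishes where `‖a‖ ≤ δ` and equals `1` where
`‖a‖ ≥ 2 * δ`. It is as regular as `a`. -/
noncomputable def cutoff (δ : ℝ) (a : E → E) (x : E) : ℝ :=
  Real.smoothTransition (‖a x‖ ^ 2 / δ ^ 2 - 1)

lemma cutoff_nonneg (δ : ℝ) (a : E → E) (x : E) : 0 ≤ cutoff δ a x :=
  Real.smoothTransition.nonneg _

lemma cutoff_le_one (δ : ℝ) (a : E → E) (x : E) : cutoff δ a x ≤ 1 :=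
  Real.smoothTransition.le_one _

lemma cutoff_eq_zero {δ : ℝ} (hδ : 0 < δ) {a : E → E} {x : E} (h : ‖a x‖ ≤ δ) :
    cutoff δ a x = 0 := by
  refine Real.smoothTransition.zero_of_nonpos ?_
  rw [sub_nonpos, div_le_one (by positivity)]
  gcongr

lemma cutoff_eq_one {δ : ℝ} (hδ : 0 < δ) {a : E → E} {x : E} (h : 2 * δ ≤ ‖a x‖) :
    cutoff δ a x = 1 := by
  refine Real.smoothTransition.one_of_one_le ?_
  rw [le_sub_iff_add_le, le_div_iff₀ (by positivity)]
  nlinarith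

lemma contDiffAt_cutoff [InnerProductSpace ℝ E] (δ : ℝ) {a : E → E} {x : E} (h : ContDiffAt ℝ 1 a x) :
    ContDiffAt ℝ 1 (cutoff δ a) x :=
  (Real.smoothTransition.contDiff (n := 1)).contDiffAt.comp x
    (((h.norm_sq ℝ).div_const _).sub contDiffAt_const)

lemma exists_bound_deriv_smoothTransition :
    ∃ M : ℝ, 0 ≤ M ∧ ∀ t, |deriv Real.smoothTransition t| ≤ M := by
  have hc : Continuous (deriv Real.smoothTransition) :=
    (Real.smoothTransition.contDiff (n := 1)).continuous_deriv (by norm_num)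
  obtain ⟨M, hM⟩ := (isCompact_Icc (a := (0 : ℝ)) (b := 1)).exists_bound_of_continuousOn
    hc.continuousOn
  refine ⟨max M 0, le_max_right _ _, fun t => ?_⟩
  by_cases ht : t ∈ Icc (0 : ℝ) 1
  · exact (hM t ht).trans (le_max_left _ _)
  · have h0 : deriv Real.smoothTransition t = 0 := by
      rcases not_and_or.1 ht with h | h
      · have : Real.smoothTransition =ᶠ[𝓝 t] fun _ => 0 := by
          filter_upwards [Iio_mem_nhds (not_le.1 h)] with s hs
          exact Real.smoothTransition.zero_of_nonpos (le_of_lt hs)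
        rw [this.deriv_eq, deriv_const]
      · have : Real.smoothTransition =ᶠ[𝓝 t] fun _ => 1 := by
          filter_upwards [Ioi_mem_nhds (not_le.1 h)] with s hs
          exact Real.smoothTransition.one_of_one_le (le_of_lt hs)
        rw [this.deriv_eq, deriv_const]
    simp [h0]

/-- The gradient of the cutoff is `O(1 / δ)` and is supported where `‖a‖ ≤ 2 * δ`. -/
lemma exists_norm_fderiv_cutoff_le (E : Type*) [NormedAddCommGroup E] [InnerProductSpace ℝ E] :
    ∃ M : ℝ, 0 ≤ M ∧ ∀ (δ : ℝ), 0 < δ → ∀ (a : E → E) (x : E),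
    ContDiffAt ℝ 1 a x →
      ‖fderiv ℝ (cutoff δ a) x‖ ≤ {x | ‖a x‖ ≤ 2 * δ}.indicator (fun _ => M / δ) x *
        ‖fderiv ℝ a x‖ := by
  obtain ⟨M, hM0, hM⟩ := exists_bound_deriv_smoothTransition
  refine ⟨4 * M, by positivity, fun δ hδ a x ha => ?_⟩
  by_cases hx : ‖a x‖ ≤ 2 * δ
  · rw [indicator_of_mem (by exact hx)]
    have h1 : HasFDerivAt (fun x => ‖a x‖ ^ 2 / δ ^ 2 - 1)
        ((δ ^ 2)⁻¹ • (2 • (innerSL ℝ (a x)).comp (fderiv ℝ a x))) x := by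
      have := ((ha.differentiableAt (by norm_num)).hasFDerivAt.norm_sq.const_mul
        (δ ^ 2)⁻¹).sub_const 1
      simpa [div_eq_inv_mul] using this
    have h2 : HasFDerivAt (cutoff δ a) (deriv Real.smoothTransition (‖a x‖ ^ 2 / δ ^ 2 - 1) •
        ((δ ^ 2)⁻¹ • (2 • (innerSL ℝ (a x)).comp (fderiv ℝ a x)))) x :=
      ((Real.smoothTransition.contDiff (n := 1)).differentiable (by norm_num)
        _).hasDerivAt.comp_hasFDerivAt x h1
    have h3 : ‖(innerSL ℝ (a x)).comp (fderiv ℝ a x)‖ ≤ ‖a x‖ * ‖fderiv ℝ a x‖ := by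
      simpa using ContinuousLinearMap.opNorm_comp_le (innerSL ℝ (a x)) (fderiv ℝ a x)
    rw [h2.fderiv, norm_smul, norm_smul, ← Nat.cast_smul_eq_nsmul ℝ, norm_smul]
    have h4 : ‖(δ ^ 2)⁻¹‖ = (δ ^ 2)⁻¹ := Real.norm_of_nonneg (by positivity)
    rw [h4, Real.norm_eq_abs]
    calc _ ≤ M * ((δ ^ 2)⁻¹ * (2 * (2 * δ * ‖fderiv ℝ a x‖))) := by
          gcongr
          · exact hM _
          · simp
          · exact h3.trans (by gcongr)
      _ = 4 * M / δ * ‖fderiv ℝ a x‖ := by field_simp; ring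
  · have h0 : cutoff δ a =ᶠ[𝓝 x] fun _ => 1 := by
      filter_upwards [ha.continuousAt.norm.eventually_const_lt (not_le.1 hx)] with y hy
      exact cutoff_eq_one hδ hy.le
    rw [h0.fderiv_eq, indicator_of_notMem (by exact hx)]
    simp

end Cutoff

lemma hasDerivAt_max_sq (ε t : ℝ) :
    HasDerivAt (fun t => max (t - ε) 0 ^ 2) (2 * max (t - ε) 0) t := by
  rcases lt_trichotomy t ε with h | h | h
  · have h1 : (fun t => max (t - ε) 0 ^ 2) =ᶠ[𝓝 t] fun _ => 0 := by
      filter_upwards [Iio_mem_nhds h] with s hs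
      have hs' : s < ε := hs
      rw [max_eq_right (by linarith), zero_pow two_ne_zero]
    rw [max_eq_right (by linarith), mul_zero]
    exact (hasDerivAt_const t 0).congr_of_eventuallyEq h1
  · subst h
    simp only [sub_self, max_self, mul_zero]
    refine HasDerivAt.of_isLittleO ?_
    have h2 : (fun s : ℝ => (s - t) ^ 2) =o[𝓝 t] fun s => s - t := by
      simpa using Asymptotics.isLittleO_pow_sub_sub (x₀ := t) one_lt_two
    refine (Asymptotics.IsBigO.of_bound 1 (Eventually.of_forall fun s => ?_)).trans_isLittleO h2
    rcases le_total s t with hs | hs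
    · simp [max_eq_right (sub_nonpos.2 hs)]; positivity
    · simp [max_eq_left (sub_nonneg.2 hs)]
  · have h1 : (fun t => max (t - ε) 0 ^ 2) =ᶠ[𝓝 t] fun s => (s - ε) ^ 2 := by
      filter_upwards [Ioi_mem_nhds h] with s hs
      have hs' : ε < s := hs
      rw [max_eq_left (by linarith)]
    rw [max_eq_left (by linarith)]
    refine HasDerivAt.congr_of_eventuallyEq ?_ h1
    have h2 := ((hasDerivAt_id t).sub_const ε).fun_pow 2
    simpa using h2

lemma contDiff_max_sq (ε : ℝ) : ContDiff ℝ 1 fun t => max (t - ε) 0 ^ 2 := by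
  rw [contDiff_one_iff_deriv]
  refine ⟨fun t => (hasDerivAt_max_sq ε t).differentiableAt, ?_⟩
  have : deriv (fun t => max (t - ε) 0 ^ 2) = fun t => 2 * max (t - ε) 0 :=
    funext fun t => (hasDerivAt_max_sq ε t).deriv
  rw [this]
  fun_prop

/-! ### The weak form of the divergence inequality -/

lemma integrable_divergence {X : Space m → Space m} (hX : ContDiff ℝ 1 X)
    (hc : HasCompactSupport X) : Integrable (divergence X) := by
  refine Continuous.integrable_of_hasCompactSupport ?_ ?_
  · exact continuous_finsetSum _ fun i _ => (EuclideanSpace.proj (𝕜 := ℝ) i).continuous.comp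
      ((hX.continuous_fderiv (by norm_num)).clm_apply continuous_const)
  · exact (hc.fderiv ℝ).comp_left
      (g := fun T : Space m →L[ℝ] Space m => ∑ i, (T (EuclideanSpace.single i 1)) i) (by simp)

/-- The vector field `N u - N v`, multiplied by `η` and cut off near the two singular sets. -/
noncomputable def testField (δ : ℝ) (η u v : Space m → ℝ) (x : Space m) : Space m :=
  (cutoff δ (alpha u) x * cutoff δ (alpha v) x * η x) • (N u x - N v x)

section TestField

variable {Ω K : Set (Space m)} {u v η : Space m → ℝ} {δ : ℝ}

lemma testField_eventuallyEq_zero (hΩ : IsOpen Ω) (hu : ContDiffOn ℝ 2 u Ω)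
    (hv : ContDiffOn ℝ 2 v Ω) (hK : IsClosed K) (hKΩ : K ⊆ Ω) (hη : ∀ x ∉ K, η x = 0)
    (hδ : 0 < δ) {x : Space m} (hx : ¬(x ∈ Ω ∧ alpha u x ≠ 0 ∧ alpha v x ≠ 0)) :
    testField δ η u v =ᶠ[𝓝 x] fun _ => 0 := by
  by_cases hxΩ : x ∈ Ω
  · have hz : ∀ {f : Space m → ℝ}, ContDiffOn ℝ 2 f Ω → alpha f x = 0 →
        ∀ᶠ y in 𝓝 x, cutoff δ (alpha f) y = 0 := fun {f} hf h0 => by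
      have hc := ((contDiffOn_alpha hΩ hf).contDiffAt (hΩ.mem_nhds hxΩ)).continuousAt.norm
      filter_upwards [hc.eventually_lt_const (by simpa [h0] using hδ : ‖alpha f x‖ < δ)] with y hy
      exact cutoff_eq_zero hδ hy.le
    by_cases h0 : alpha u x = 0
    · filter_upwards [hz hu h0] with y hy
      simp [testField, hy]
    · have h1 : alpha v x = 0 := by
        by_contra h1
        exact hx ⟨hxΩ, h0, h1⟩
      filter_upwards [hz hv h1] with y hy
      simp [testField, hy]
  · filter_upwards [hK.isOpen_compl.mem_nhds fun h => hxΩ (hKΩ h)] with y hy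
    simp [testField, hη y hy]

lemma contDiff_testField (hΩ : IsOpen Ω) (hu : ContDiffOn ℝ 2 u Ω)
    (hv : ContDiffOn ℝ 2 v Ω) (hK : IsClosed K) (hKΩ : K ⊆ Ω) (hη : ∀ x ∉ K, η x = 0)
    (hηc : ContDiff ℝ 1 η) (hδ : 0 < δ) : ContDiff ℝ 1 (testField δ η u v) := by
  refine contDiff_iff_contDiffAt.2 fun x => ?_
  by_cases hx : x ∈ Ω ∧ alpha u x ≠ 0 ∧ alpha v x ≠ 0
  · have hau := (contDiffOn_alpha hΩ hu).contDiffAt (hΩ.mem_nhds hx.1)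
    have hav := (contDiffOn_alpha hΩ hv).contDiffAt (hΩ.mem_nhds hx.1)
    exact (((contDiffAt_cutoff δ hau).mul (contDiffAt_cutoff δ hav)).mul hηc.contDiffAt).smul
      ((contDiffAt_N hau hx.2.1).sub (contDiffAt_N hav hx.2.2))
  · exact contDiffAt_const.congr_of_eventuallyEq
      (testField_eventuallyEq_zero hΩ hu hv hK hKΩ hη hδ hx)

lemma le_divergence_testField (hΩ : IsOpen Ω) (hu : ContDiffOn ℝ 2 u Ω)
    (hv : ContDiffOn ℝ 2 v Ω) (hηc : ContDiff ℝ 1 η) (hη0 : ∀ x, 0 ≤ η x) {x : Space m}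
    (hxΩ : x ∈ Ω) (hxu : alpha u x ≠ 0) (hxv : alpha v x ≠ 0)
    (hdiv : divergence (N v) x ≤ divergence (N u) x) :
    cutoff δ (alpha u) x * cutoff δ (alpha v) x * fderiv ℝ η x (N u x - N v x)
      - 2 * (η x * ‖fderiv ℝ (cutoff δ (alpha u)) x‖)
      - 2 * (η x * ‖fderiv ℝ (cutoff δ (alpha v)) x‖) ≤ divergence (testField δ η u v) x := by
  have hau := (contDiffOn_alpha hΩ hu).contDiffAt (hΩ.mem_nhds hxΩ)
  have hav := (contDiffOn_alpha hΩ hv).contDiffAt (hΩ.mem_nhds hxΩ)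
  have d1 := (contDiffAt_cutoff δ hau).differentiableAt (by norm_num)
  have d2 := (contDiffAt_cutoff δ hav).differentiableAt (by norm_num)
  have d3 := hηc.differentiable (by norm_num) x
  have d4 := (contDiffAt_N hau hxu).differentiableAt (by norm_num)
  have d5 := (contDiffAt_N hav hxv).differentiableAt (by norm_num)
  have hY : ‖N u x - N v x‖ ≤ 2 := by
    linarith [norm_sub_le (N u x) (N v x), norm_N_le u x, norm_N_le v x]
  have key : divergence (testField δ η u v) x =
      cutoff δ (alpha u) x * cutoff δ (alpha v) x * η x * (divergence (N u) x - divergence (N v) x)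
      + (cutoff δ (alpha u) x * cutoff δ (alpha v) x * fderiv ℝ η x (N u x - N v x)
      + η x * (cutoff δ (alpha u) x * fderiv ℝ (cutoff δ (alpha v)) x (N u x - N v x)
      + cutoff δ (alpha v) x * fderiv ℝ (cutoff δ (alpha u)) x (N u x - N v x))) := by
    have h1 := divergence_smul (f := fun x => cutoff δ (alpha u) x * cutoff δ (alpha v) x * η x)
      (Y := fun x => N u x - N v x) ((d1.mul d2).mul d3) (d4.sub d5)
    rw [divergence_sub d4 d5, fderiv_fun_mul (d1.fun_mul d2) d3, fderiv_fun_mul d1 d2] at h1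
    exact h1.trans (by simp; ring)
  have hop : ∀ f : Space m → ℝ, -(2 * (η x * ‖fderiv ℝ (cutoff δ (alpha f)) x‖)) ≤
      η x * fderiv ℝ (cutoff δ (alpha f)) x (N u x - N v x) := fun f => by
    have h2 := neg_le_of_abs_le ((fderiv ℝ (cutoff δ (alpha f)) x).le_opNorm (N u x - N v x))
    have h3 : ‖fderiv ℝ (cutoff δ (alpha f)) x‖ * ‖N u x - N v x‖ ≤
      ‖fderiv ℝ (cutoff δ (alpha f)) x‖ * 2 := by gcongr
    nlinarith [hη0 x]
  have hterm : ∀ f g : Space m → ℝ, -(2 * (η x * ‖fderiv ℝ (cutoff δ (alpha f)) x‖)) ≤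
      cutoff δ (alpha g) x * (η x * fderiv ℝ (cutoff δ (alpha f)) x (N u x - N v x)) := by
    intro f g
    have h5 : 0 ≤ 2 * (η x * ‖fderiv ℝ (cutoff δ (alpha f)) x‖) := by
      have := hη0 x
      positivity
    nlinarith [hop f, cutoff_nonneg δ (alpha g) x, cutoff_le_one δ (alpha g) x]
  have h6 : 0 ≤ cutoff δ (alpha u) x * cutoff δ (alpha v) x * η x *
      (divergence (N u) x - divergence (N v) x) :=
    mul_nonneg (mul_nonneg (mul_nonneg (cutoff_nonneg _ _ _) (cutoff_nonneg _ _ _)) (hη0 x))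
      (sub_nonneg.2 hdiv)
  rw [key]
  linarith [hterm u v, hterm v u]

end TestField

lemma exists_mul_norm_fderiv_cutoff_le {Ω K : Set (Space m)} {η : Space m → ℝ}
    (hΩ : IsOpen Ω) (hK : IsCompact K) (hKΩ : K ⊆ Ω) (hη : ∀ x ∉ K, η x = 0)
    (hηc : ContDiff ℝ 1 η) {f : Space m → ℝ} (hf : ContDiffOn ℝ 2 f Ω) :
    ∃ D : ℝ, 0 ≤ D ∧ ∀ δ > 0, ∀ x, 2 * (η x * ‖fderiv ℝ (cutoff δ (alpha f)) x‖) ≤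
      (K ∩ {x | ‖alpha f x‖ ≤ 2 * δ}).indicator (fun _ => D / δ) x := by
  obtain ⟨M, hM0, hM⟩ := exists_norm_fderiv_cutoff_le (Space m)
  have hα := contDiffOn_alpha hΩ hf
  obtain ⟨Q, hQ⟩ := hK.exists_bound_of_continuousOn
    ((hα.continuousOn_fderiv_of_isOpen hΩ (by norm_num)).mono hKΩ)
  obtain ⟨H, hH⟩ := hK.exists_bound_of_continuousOn hηc.continuous.continuousOn
  refine ⟨2 * (|H| * (M * |Q|)), by positivity, fun δ hδ x => ?_⟩
  by_cases hxK : x ∈ K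
  · have h1 := hM δ hδ (alpha f) x (hα.contDiffAt (hΩ.mem_nhds (hKΩ hxK)))
    have h2 : η x ≤ |H| := (le_abs_self _).trans ((hH x hxK).trans (le_abs_self _))
    have h3 : ‖fderiv ℝ (alpha f) x‖ ≤ |Q| := (hQ x hxK).trans (le_abs_self _)
    by_cases hx : ‖alpha f x‖ ≤ 2 * δ
    · rw [indicator_of_mem (by exact hx)] at h1
      rw [indicator_of_mem (by exact ⟨hxK, hx⟩)]
      calc 2 * (η x * ‖fderiv ℝ (cutoff δ (alpha f)) x‖) ≤ 2 * (|H| * (M / δ * |Q|)) := by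
            gcongr
            exact h1.trans (by gcongr)
        _ = 2 * (|H| * (M * |Q|)) / δ := by ring
    · rw [indicator_of_notMem (by exact hx), zero_mul] at h1
      rw [indicator_of_notMem (by exact fun h => hx h.2), le_antisymm h1 (norm_nonneg _)]
      simp
  · rw [indicator_of_notMem (by exact fun h => hxK h.1), hη x hxK]
    simp

/-- Testing `div N(u) ≥ div N(v)` with a nonnegative function `η`. The singular sets do not
matter: cutting off the region where `‖∇u + F‖ ≤ δ` or `‖∇v + F‖ ≤ δ` costs an error `O(1 / δ)`
on a set of volume `O(δ ^ m)`, whose integral tends to `0` since `m ≥ 2`. -/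
lemma fderiv_apply_N_sub_N_nonpos (hm : 2 ≤ m) {Ω K : Set (Space m)} {u v η : Space m → ℝ}
    (hΩ : IsOpen Ω) (hu : ContDiffOn ℝ 2 u Ω) (hv : ContDiffOn ℝ 2 v Ω)
    (hK : IsCompact K) (hKΩ : K ⊆ Ω) (hη : ∀ x ∉ K, η x = 0)
    (hηc : ContDiff ℝ 1 η) (hη0 : ∀ x, 0 ≤ η x)
    (hdiv : ∀ x ∈ Ω, alpha u x ≠ 0 → alpha v x ≠ 0 → divergence (N v) x ≤ divergence (N u) x)
    (hpos : ∀ x ∈ Ω, alpha u x ≠ 0 → alpha v x ≠ 0 → 0 ≤ fderiv ℝ η x (N u x - N v x))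
    {p : Space m} (hp : p ∈ Ω) (hpu : alpha u p ≠ 0) (hpv : alpha v p ≠ 0) :
    fderiv ℝ η p (N u p - N v p) ≤ 0 := by
  by_contra! hΦ
  have hau := (contDiffOn_alpha hΩ hu).contDiffAt (hΩ.mem_nhds hp)
  have hav := (contDiffOn_alpha hΩ hv).contDiffAt (hΩ.mem_nhds hp)
  set c := fderiv ℝ η p (N u p - N v p) / 2 with hcdef
  have hc : 0 < c := by positivity
  -- a ball around `p` on which the integrand is at least `c` and the cutoffs are eventually `1`
  have hev : ∀ᶠ x in 𝓝 p, x ∈ Ω ∧ c < fderiv ℝ η x (N u x - N v x) ∧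
      ‖alpha u p‖ / 2 < ‖alpha u x‖ ∧ ‖alpha v p‖ / 2 < ‖alpha v x‖ := by
    have hcont : ContinuousAt (fun x => fderiv ℝ η x (N u x - N v x)) p :=
      (hηc.continuous_fderiv (by norm_num)).continuousAt.clm_apply
        ((contDiffAt_N hau hpu).continuousAt.sub (contDiffAt_N hav hpv).continuousAt)
    exact (hΩ.eventually_mem hp).and ((hcont.eventually_const_lt (half_lt_self hΦ)).and
      ((hau.continuousAt.norm.eventually_const_lt (half_lt_self (norm_pos_iff.2 hpu))).and
        (hav.continuousAt.norm.eventually_const_lt (half_lt_self (norm_pos_iff.2 hpv)))))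
  obtain ⟨r, hr, hB⟩ := Metric.eventually_nhds_iff_ball.1 hev
  set B := Metric.ball p r
  obtain ⟨Du, hDu0, hDu⟩ := exists_mul_norm_fderiv_cutoff_le hΩ hK hKΩ hη hηc hu
  obtain ⟨Dv, hDv0, hDv⟩ := exists_mul_norm_fderiv_cutoff_le hΩ hK hKΩ hη hηc hv
  obtain ⟨Cu, hCu, hVu⟩ := exists_volume_inter_norm_alpha_le hΩ hu hK hKΩ
  obtain ⟨Cv, hCv, hVv⟩ := exists_volume_inter_norm_alpha_le hΩ hv hK hKΩ
  have hA : ∀ {f : Space m → ℝ}, ContDiffOn ℝ 2 f Ω → ∀ δ : ℝ,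
      MeasurableSet (K ∩ {x | ‖alpha f x‖ ≤ 2 * δ}) := fun hf δ =>
    (((contDiffOn_alpha hΩ hf).continuousOn.mono hKΩ).norm.preimage_isClosed_of_isClosed
      hK.isClosed isClosed_Iic).measurableSet
  have hAfin : ∀ {f : Space m → ℝ} (δ : ℝ), volume (K ∩ {x | ‖alpha f x‖ ≤ 2 * δ}) ≠ ⊤ :=
    fun δ => ((measure_mono inter_subset_left).trans_lt hK.measure_lt_top).ne
  have hreal : ∀ {f : Space m → ℝ} {C : ℝ≥0∞}, C ≠ ⊤ →
      (∀ δ : ℝ, 0 ≤ δ → volume (K ∩ {x | ‖alpha f x‖ ≤ δ}) ≤ C * ENNReal.ofReal (δ ^ m)) →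
      ∀ δ : ℝ, 0 ≤ δ → 2 * δ ≤ 1 →
        volume.real (K ∩ {x | ‖alpha f x‖ ≤ 2 * δ}) ≤ C.toReal * (4 * δ ^ 2) := by
    intro f C hC hV δ hδ hδ1
    have h1 := ENNReal.toReal_mono (ENNReal.mul_ne_top hC ENNReal.ofReal_ne_top)
      (hV (2 * δ) (by positivity))
    rw [ENNReal.toReal_mul, ENNReal.toReal_ofReal (by positivity)] at h1
    refine h1.trans (mul_le_mul_of_nonneg_left ?_ ENNReal.toReal_nonneg)
    calc (2 * δ) ^ m ≤ (2 * δ) ^ 2 := pow_le_pow_of_le_one (by positivity) hδ1 hm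
      _ = 4 * δ ^ 2 := by ring
  -- the resulting estimate, uniform in the cutoff parameter
  have hmain : ∀ δ : ℝ, 0 < δ → 2 * δ ≤ 1 → 2 * δ ≤ ‖alpha u p‖ / 2 → 2 * δ ≤ ‖alpha v p‖ / 2 →
      c * volume.real B ≤ 4 * (Du * Cu.toReal + Dv * Cv.toReal) * δ := by
    intro δ hδ hδ1 hδu hδv
    have hX := contDiff_testField hΩ hu hv hK.isClosed hKΩ hη hηc hδ
    have hXc : HasCompactSupport (testField δ η u v) :=
      HasCompactSupport.intro hK fun x hx => by simp [testField, hη x hx]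
    have hle : ∀ x, B.indicator (fun _ => c) x
        - (K ∩ {x | ‖alpha u x‖ ≤ 2 * δ}).indicator (fun _ => Du / δ) x
        - (K ∩ {x | ‖alpha v x‖ ≤ 2 * δ}).indicator (fun _ => Dv / δ) x
        ≤ divergence (testField δ η u v) x := by
      intro x
      by_cases hx : x ∈ Ω ∧ alpha u x ≠ 0 ∧ alpha v x ≠ 0
      · refine le_trans ?_ (le_divergence_testField (δ := δ) hΩ hu hv hηc hη0 hx.1 hx.2.1 hx.2.2
          (hdiv x hx.1 hx.2.1 hx.2.2))
        have h1 : B.indicator (fun _ => c) x ≤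
            cutoff δ (alpha u) x * cutoff δ (alpha v) x * fderiv ℝ η x (N u x - N v x) := by
          by_cases hxB : x ∈ B
          · have h2 := hB x hxB
            rw [indicator_of_mem hxB, cutoff_eq_one hδ (hδu.trans h2.2.2.1.le),
              cutoff_eq_one hδ (hδv.trans h2.2.2.2.le), one_mul, one_mul]
            exact h2.2.1.le
          · rw [indicator_of_notMem hxB]
            exact mul_nonneg (mul_nonneg (cutoff_nonneg _ _ _) (cutoff_nonneg _ _ _))
              (hpos x hx.1 hx.2.1 hx.2.2)
        linarith [hDu δ hδ x, hDv δ hδ x]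
      · have hxB : x ∉ B := fun hxB => by
          have h2 := hB x hxB
          refine hx ⟨h2.1, norm_pos_iff.1 (lt_trans ?_ h2.2.2.1),
            norm_pos_iff.1 (lt_trans ?_ h2.2.2.2)⟩ <;> positivity
        rw [divergence_eq_zero_of_eventuallyEq
          (testField_eventuallyEq_zero hΩ hu hv hK.isClosed hKΩ hη hδ hx), indicator_of_notMem hxB]
        have h3 : 0 ≤ (K ∩ {x | ‖alpha u x‖ ≤ 2 * δ}).indicator (fun _ => Du / δ) x :=
          indicator_nonneg (fun _ _ => by positivity) x
        have h4 : 0 ≤ (K ∩ {x | ‖alpha v x‖ ≤ 2 * δ}).indicator (fun _ => Dv / δ) x :=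
          indicator_nonneg (fun _ _ => by positivity) x
        linarith
    have i1 : Integrable (B.indicator (fun _ => c)) :=
      (integrableOn_const (Metric.isBounded_ball.measure_lt_top.ne)).integrable_indicator
        Metric.isOpen_ball.measurableSet
    have i2 : Integrable ((K ∩ {x | ‖alpha u x‖ ≤ 2 * δ}).indicator (fun _ => Du / δ)) :=
      (integrableOn_const (hAfin δ)).integrable_indicator (hA hu δ)
    have i3 : Integrable ((K ∩ {x | ‖alpha v x‖ ≤ 2 * δ}).indicator (fun _ => Dv / δ)) :=
      (integrableOn_const (hAfin δ)).integrable_indicator (hA hv δ)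
    have hint := integral_mono ((i1.sub i2).sub i3) (integrable_divergence hX hXc) hle
    rw [integral_divergence_eq_zero hX hXc, integral_sub' (i1.sub i2) i3, integral_sub' i1 i2,
      integral_indicator_const _ Metric.isOpen_ball.measurableSet,
      integral_indicator_const _ (hA hu δ), integral_indicator_const _ (hA hv δ)] at hint
    simp only [smul_eq_mul] at hint
    have b1 : volume.real (K ∩ {x | ‖alpha u x‖ ≤ 2 * δ}) * (Du / δ) ≤
        Cu.toReal * (4 * δ ^ 2) * (Du / δ) :=
      mul_le_mul_of_nonneg_right (hreal hCu hVu δ hδ.le hδ1) (by positivity)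
    have b2 : volume.real (K ∩ {x | ‖alpha v x‖ ≤ 2 * δ}) * (Dv / δ) ≤
        Cv.toReal * (4 * δ ^ 2) * (Dv / δ) :=
      mul_le_mul_of_nonneg_right (hreal hCv hVv δ hδ.le hδ1) (by positivity)
    have e : Cu.toReal * (4 * δ ^ 2) * (Du / δ) + Cv.toReal * (4 * δ ^ 2) * (Dv / δ) =
        4 * (Du * Cu.toReal + Dv * Cv.toReal) * δ := by
      field_simp
    linarith
  have hBpos : 0 < c * volume.real B :=
    mul_pos hc (ENNReal.toReal_pos (Metric.measure_ball_pos volume p hr).ne'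
      Metric.isBounded_ball.measure_lt_top.ne)
  have hlim : Tendsto (fun δ : ℝ => 4 * (Du * Cu.toReal + Dv * Cv.toReal) * δ) (𝓝[>] 0) (𝓝 0) := by
    have : Continuous fun δ : ℝ => 4 * (Du * Cu.toReal + Dv * Cv.toReal) * δ := by fun_prop
    simpa using (this.tendsto 0).mono_left nhdsWithin_le_nhds
  refine hBpos.not_ge (ge_of_tendsto hlim ?_)
  have hsmall : ∀ t : ℝ, 0 < t → ∀ᶠ δ : ℝ in 𝓝[>] 0, 2 * δ ≤ t := fun t ht => by
    filter_upwards [nhdsWithin_le_nhds (Iio_mem_nhds (half_pos ht))] with δ hδ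
    have : δ < t / 2 := hδ
    linarith
  filter_upwards [self_mem_nhdsWithin, hsmall 1 one_pos,
    hsmall _ (half_pos (norm_pos_iff.2 hpu)), hsmall _ (half_pos (norm_pos_iff.2 hpv))]
    with δ h1 h2 h3 h4
  exact hmain δ h1 h2 h3 h4

/-- With `w = u - v` and `η = max (w - ε) 0 ^ 2` the tested quantity is
`2 * max (w - ε) 0 * ⟪∇w, N(u) - N(v)⟫`, a nonnegative multiple of `‖N(u) - N(v)‖ ^ 2`. -/
lemma N_eq_of_lt (hm : 2 ≤ m) {Ω : Set (Space m)} {u v : Space m → ℝ}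
    (hΩ : IsOpen Ω) (hb : Bornology.IsBounded Ω)
    (hu : ContDiffOn ℝ 2 u Ω) (hv : ContDiffOn ℝ 2 v Ω)
    (huc : ContinuousOn u (closure Ω)) (hvc : ContinuousOn v (closure Ω))
    (hdiv : ∀ x ∈ Ω, alpha u x ≠ 0 → alpha v x ≠ 0 → divergence (N v) x ≤ divergence (N u) x)
    (hf : ∀ x ∈ frontier Ω, u x ≤ v x)
    {p : Space m} (hp : p ∈ Ω) (hlt : v p < u p) (hpu : alpha u p ≠ 0) (hpv : alpha v p ≠ 0) :
    N u p = N v p := by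
  set ε := (u p - v p) / 2 with hεdef
  have hε : 0 < ε := by rw [hεdef]; linarith
  set K := closure Ω ∩ (fun x => u x - v x) ⁻¹' Ici ε with hKdef
  have hwc : ContinuousOn (fun x => u x - v x) (closure Ω) := huc.sub hvc
  have hK : IsCompact K := Metric.isCompact_of_isClosed_isBounded
    (hwc.preimage_isClosed_of_isClosed isClosed_closure isClosed_Ici)
    (hb.closure.subset inter_subset_left)
  have hKΩ : K ⊆ Ω := fun x hx => by
    by_contra hxΩ
    have h1 : ε ≤ u x - v x := hx.2
    linarith [hf x ⟨hx.1, fun h => hxΩ (interior_subset h)⟩]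
  set η : Space m → ℝ := Ω.indicator fun x => max (u x - v x - ε) 0 ^ 2 with hηdef
  have hη : ∀ x ∉ K, η x = 0 := fun x hx => by
    by_cases hxΩ : x ∈ Ω
    · have h1 : u x - v x < ε := not_le.1 fun h => hx ⟨subset_closure hxΩ, h⟩
      rw [hηdef, indicator_of_mem hxΩ, max_eq_right (by linarith), zero_pow two_ne_zero]
    · exact indicator_of_notMem hxΩ _
  have hηΩ : ∀ x ∈ Ω, η =ᶠ[𝓝 x] fun x => max (u x - v x - ε) 0 ^ 2 := fun x hx => by
    filter_upwards [hΩ.mem_nhds hx] with y hy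
    exact indicator_of_mem hy _
  have hηc : ContDiff ℝ 1 η := by
    refine contDiff_iff_contDiffAt.2 fun x => ?_
    by_cases hxΩ : x ∈ Ω
    · refine ContDiffAt.congr_of_eventuallyEq ?_ (hηΩ x hxΩ)
      have hw : ContDiffAt ℝ 1 (fun x => u x - v x) x :=
        ((hu.sub hv).contDiffAt (hΩ.mem_nhds hxΩ)).of_le (by norm_num)
      exact (contDiff_max_sq ε).contDiffAt.comp x hw
    · refine contDiffAt_const (c := (0 : ℝ)) |>.congr_of_eventuallyEq ?_
      filter_upwards [hK.isClosed.isOpen_compl.mem_nhds fun h => hxΩ (hKΩ h)] with y hy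
      exact hη y hy
  have hη0 : ∀ x, 0 ≤ η x := fun x => indicator_nonneg (fun _ _ => sq_nonneg _) x
  have hderiv : ∀ x ∈ Ω, alpha u x ≠ 0 → alpha v x ≠ 0 → fderiv ℝ η x (N u x - N v x) =
      2 * max (u x - v x - ε) 0 * ((‖alpha u x‖ + ‖alpha v x‖) / 2 * ‖N u x - N v x‖ ^ 2) := by
    intro x hx hxu hxv
    have hdu := ((hu.contDiffAt (hΩ.mem_nhds hx)).differentiableAt (by norm_num)).hasFDerivAt
    have hdv := ((hv.contDiffAt (hΩ.mem_nhds hx)).differentiableAt (by norm_num)).hasFDerivAt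
    have h1 := (hasDerivAt_max_sq ε (u x - v x)).comp_hasFDerivAt x (hdu.sub hdv)
    have h2 : fderiv ℝ η x = (2 * max (u x - v x - ε) 0) • (fderiv ℝ u x - fderiv ℝ v x) :=
      (hηΩ x hx).fderiv_eq.trans h1.fderiv
    have h3 : (fderiv ℝ u x - fderiv ℝ v x) (N u x - N v x) =
        ⟪alpha u x - alpha v x, N u x - N v x⟫ := by
      have h4 : alpha u x - alpha v x = gradient u x - gradient v x := add_sub_add_right_eq_sub _ _ _
      rw [h4, inner_sub_left, inner_gradient, inner_gradient, sub_apply]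
    rw [h2, smul_apply, smul_eq_mul, h3]
    congr 1
    exact inner_sub_normalize_sub hxu hxv
  have hle := fderiv_apply_N_sub_N_nonpos hm hΩ hu hv hK hKΩ hη hηc hη0 hdiv
    (fun x hx hxu hxv => by rw [hderiv x hx hxu hxv]; positivity) hp hpu hpv
  rw [hderiv p hp hpu hpv] at hle
  by_contra hne
  have h1 : 0 < ‖N u p - N v p‖ := norm_pos_iff.2 (sub_ne_zero.2 hne)
  have h2 : 0 < max (u p - v p - ε) 0 := lt_max_of_lt_left (by rw [hεdef]; linarith)
  have h3 : 0 < ‖alpha u p‖ := norm_pos_iff.2 hpu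
  exact hle.not_gt (by positivity)

end HeisenbergGraph

open HeisenbergGraph

theorem theoremC (m : ℕ) (hm : 2 ≤ m) (Ω : Set (HeisenbergGraph.Space m)) (hΩ : IsOpen Ω) :
    -- the comparison principle on bounded domains
    (IsConnected Ω → Bornology.IsBounded Ω →
      ∀ u v : HeisenbergGraph.Space m → ℝ,
        ContDiffOn ℝ 2 u Ω → ContinuousOn u (closure Ω) →
        ContDiffOn ℝ 2 v Ω → ContinuousOn v (closure Ω) →
        (∀ p ∈ Ω \ (HeisenbergGraph.singularSet Ω u ∪ HeisenbergGraph.singularSet Ω v),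
          HeisenbergGraph.divergence (HeisenbergGraph.N v) p
            ≤ HeisenbergGraph.divergence (HeisenbergGraph.N u) p) →
        (∀ p ∈ frontier Ω, u p ≤ v p) →
        ∀ p ∈ Ω, u p ≤ v p) ∧
    -- the size of the singular set
    (∀ u : HeisenbergGraph.Space m → ℝ, ContDiffOn ℝ 2 u Ω →
      (∀ p ∈ HeisenbergGraph.singularSet Ω u,
        ∃ V : Set (HeisenbergGraph.Space m), IsOpen V ∧ p ∈ V ∧ V ⊆ Ω ∧
          (∃ g : HeisenbergGraph.Space m → EuclideanSpace ℝ (Fin m),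
            ContDiffOn ℝ 1 g V ∧
            (∀ q ∈ V, Function.Surjective (fderiv ℝ g q)) ∧
            ∀ q ∈ HeisenbergGraph.singularSet Ω u ∩ V, g q = 0) ∧
          μH[(m : ℝ)] (HeisenbergGraph.singularSet Ω u ∩ V) < ⊤) ∧
      μH[2 * (m : ℝ) - 1] (HeisenbergGraph.singularSet Ω u) = 0) := by
  have hm' : (2 : ℝ) ≤ m := by exact_mod_cast hm
  refine ⟨fun _ hb u v hu huc hv hvc hdiv hf p hp => ?_, fun u hu =>
    ⟨fun p hp => exists_submersion_near_singular_point hΩ hu hp,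
      hausdorffMeasure_singularSet_eq_zero hΩ hu (by linarith)⟩⟩
  have hdiv' : ∀ x ∈ Ω, alpha u x ≠ 0 → alpha v x ≠ 0 →
      divergence (N v) x ≤ divergence (N u) x := fun x hx hxu hxv =>
    hdiv x ⟨hx, fun h => h.elim (fun h => hxu h.2) (fun h => hxv h.2)⟩
  have : Nonempty (Fin m) := ⟨⟨0, by omega⟩⟩
  have hw := nonpos_of_fderiv_eq_zero hΩ hb (huc.sub hvc) (fun q hq hpos => ?_)
    (fun q hq => sub_nonpos.2 (hf q hq)) hp
  · exact sub_nonpos.1 hw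
  · have hdu := (hu.contDiffAt (hΩ.mem_nhds hq)).differentiableAt (by norm_num)
    have hdv := (hv.contDiffAt (hΩ.mem_nhds hq)).differentiableAt (by norm_num)
    refine ⟨hdu.sub hdv, ?_⟩
    rw [fderiv_sub hdu hdv, sub_eq_zero]
    exact fderiv_eq_of_N_eq hm hΩ hu hv
      (fun x hx hlt hxu hxv => N_eq_of_lt hm hΩ hb hu hv huc hvc hdiv' hf hx hlt hxu hxv)
      hq (sub_pos.1 hpos)
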